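/- For every integer $k\ge 0$ there is a constant $\alpha\in(0,1]$, depending only on $k$, such that every instance of the delegated stochastic probing problem with no outer constraint, whose inner constraint is the intersection of $k$ constraints, each a matroid, a knapsack or a matching constraint, has a deterministic $\alpha$-policy. Here an instance consists of a finite ground set $E$, independent pairs $(X_e,Y_e)\sim\mu_e$ of nonnegative real utilities (for the principal and the agent) for $e\in E$, and downwards-closed families $\mathcal I_{\rm out},\mathcal I_{\rm in}\subseteq 2^E$; "no outer constraint" means $\mathcal I_{\rm out}=2^E$. A matroid constraint consists of the independent sets of a matroid on $E$; a knapsack constraint of the sets $S$ with $\sum_{e\in S}s_e\le C$, for some sizes $s_e\ge 0$ and capacity $C\ge 0$; a matching constraint of the matchings of a loopless (multi)graph whose edges are the elements of $E$. For $G\subseteq E$ put $x(G)=\sum_{e\in G}X_e$, $y(G)=\sum_{e\in G}Y_e$ and $\Omega_G=\{(e,X_e,Y_e):e\in G\}$. A deterministic policy is a family $\mathcal R$ of (acceptable) sets of outcomes $(e,x,y)$ with $(x,y)\in\operatorname{supp}\mu_e$, the elements of each set being distinct and forming a member of $\mathcal I_{\rm in}$. An adaptive probing algorithm probes elements one at a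 time, each at most once, keeping the probed set in $\mathcal I_{\rm out}$; its next step may depend on the utilities observed so far. If the elements of $F$ are probed, a non-delegating principal gets $u(F)=\max\{x(G): G\subseteq F,\ G\in\mathcal I_{\rm in}\}$. Under the policy $\mathcal R$ the agent proposes some $G\subseteq F$ with $\Omega_G\in\mathcal R$ that maximizes $y(G)$ (ties broken arbitrarily, even adversarially), and the principal gets $v_{\mathcal R}(F)=x(G)$; if there is no such $G$, then $v_{\mathcal R}(F)=0$. The set $F^*_{\mathcal R}$ is probed by an adaptive algorithm that maximizes the agent's expected utility; since probing is free, among such algorithms the agent uses one that maximizes the probability that he has an acceptable set to propose (without an outer constraint, probing all of $E$ is such an algorithm). The policy $\mathcal R$ is an $\alpha$-policy if $$\mathbb E\,v_{\mathcal R}(F^*_{\mathcal R})\ \ge\ \alpha\,\sup_{F^*}\mathbb E\,u(F^*),$$ for every such response of the agent, where the supremum is over all sets $F^*$ probed by adaptive probing algorithms. -/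

import Mathlib

open MeasureTheory
open scoped NNReal ENNReal

namespace DelegatedProbing

/-- A downwards-closed set system on the ground set `E`. -/
structure SetSystem (E : Type*) where
  Feasible : Finset E → Prop
  empty_feasible : Feasible ∅
  feasible_of_subset : ∀ {S T : Finset E}, S ⊆ T → Feasible T → Feasible S

namespace SetSystem

variable {E : Type*}

/-- The set system in which every set is feasible. -/
def trivial (E : Type*) : SetSystem E where
  Feasible _ := True
  empty_feasible := True.intro
  feasible_of_subset _ _ := True.intro

/-- The feasible sets are the independent sets of a matroid on `E`. -/
def IsMatroid (M : SetSystem E) : Prop :=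
  ∃ N : Matroid E, N.E = Set.univ ∧ ∀ S : Finset E, M.Feasible S ↔ N.Indep (S : Set E)

/-- The feasible sets are the sets of total size at most some capacity. -/
def IsKnapsack (M : SetSystem E) : Prop :=
  ∃ (size : E → ℝ≥0) (capacity : ℝ≥0),
    ∀ S : Finset E, M.Feasible S ↔ ∑ e ∈ S, size e ≤ capacity

/-- The elements are the edges of a loopless (multi)graph on a vertex set `V`, and the feasible
sets are its matchings: sets of edges no two of which share a vertex. (As the ground sets below
are finite, it is no restriction that `V` lives in `Type`.) -/
def IsMatching (M : SetSystem E) : Prop :=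
  ∃ (V : Type) (ends : E → Sym2 V), (∀ e, ¬ (ends e).IsDiag) ∧
    ∀ S : Finset E, M.Feasible S ↔
      ∀ e ∈ S, ∀ f ∈ S, e ≠ f → ∀ v : V, ¬ (v ∈ ends e ∧ v ∈ ends f)

/-- `M` is the intersection of `k` constraints, each a matroid, knapsack or matching constraint. -/
def IsIntersectionOf (M : SetSystem E) (k : ℕ) : Prop :=
  ∃ C : Fin k → SetSystem E,
    (∀ i, (C i).IsMatroid ∨ (C i).IsKnapsack ∨ (C i).IsMatching) ∧
    ∀ S : Finset E, M.Feasible S ↔ ∀ i, (C i).Feasible S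

end SetSystem

/-- An instance of the delegated stochastic probing problem on the ground set `E`. The measure
`μ e` is the joint law of the utilities `(X_e, Y_e)` of the principal and of the agent. -/
structure Problem (E : Type*) where
  μ : E → Measure (ℝ≥0 × ℝ≥0)
  isProb : ∀ e, IsProbabilityMeasure (μ e)
  outer : SetSystem E
  inner : SetSystem E

/-- A realization of the utility pairs of all elements. -/
abbrev State (E : Type*) := E → ℝ≥0 × ℝ≥0

/-- An outcome `(e, x, y)`. -/
abbrev Outcome (E : Type*) := E × ℝ≥0 × ℝ≥0

/-- `x(G)`, the principal's utility for the elements of `G` in the state `ω`. -/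
def xUtil {E : Type*} (ω : State E) (G : Finset E) : ℝ≥0 := ∑ e ∈ G, (ω e).1

/-- `y(G)`, the agent's utility for the elements of `G` in the state `ω`. -/
def yUtil {E : Type*} (ω : State E) (G : Finset E) : ℝ≥0 := ∑ e ∈ G, (ω e).2

/-- `Ω_G`, the set of outcomes of the elements of `G` in the state `ω`. -/
def outcomes {E : Type*} (ω : State E) (G : Finset E) : Finset (Outcome E) :=
  G.map ⟨fun e => (e, ω e), fun _ _ h => congrArg Prod.fst h⟩

/-- A deterministic adaptive probing procedure: finish, or probe `e` and continue in a way that may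
depend on the utilities observed. -/
inductive ProbeTree (E : Type*) where
  | done : ProbeTree E
  | probe (e : E) (next : ℝ≥0 × ℝ≥0 → ProbeTree E) : ProbeTree E

namespace ProbeTree

variable {E : Type*}

open Classical in
/-- The set of elements probed in the state `ω`. -/
noncomputable def probed (ω : State E) : ProbeTree E → Finset E
  | done => ∅
  | probe e next => insert e (probed ω (next (ω e)))

open Classical in
/-- After the elements of `P` have been probed, the procedure probes no element twice, and the
set of probed elements stays feasible in `M`. -/
def Valid (M : SetSystem E) (P : Finset E) : ProbeTree E → Prop
  | done => True
  | probe e next => e ∉ P ∧ M.Feasible (insert e P) ∧ ∀ z, Valid M (insert e P) (next z)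

end ProbeTree

namespace Problem

variable {E : Type*} [Fintype E] (I : Problem E)

/-- The law of the state: the utility pairs of different elements are independent. -/
noncomputable def law : Measure (State E) := Measure.pi I.μ

/-- An adaptive probing algorithm that respects the outer constraint. -/
structure Algorithm where
  tree : ProbeTree E
  valid : tree.Valid I.outer ∅
  measurable : ∀ F : Finset E, MeasurableSet {ω : State E | tree.probed ω = F}

/-- `Ω_in`: the sets of outcomes with distinct elements that are feasible in the inner
constraint. -/
def innerOutcomes : Set (Finset (Outcome E)) :=
  {T | (∀ o ∈ T, o.2 ∈ (I.μ o.1).support) ∧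
    ∃ G : Finset E, I.inner.Feasible G ∧ ∃ ω : State E, T = outcomes ω G}

open Classical in
/-- `u(F) = max {x(G) | G ⊆ F, G feasible in the inner constraint}`. -/
noncomputable def principalValue (ω : State E) (F : Finset E) : ℝ≥0 :=
  (F.powerset.filter fun G => I.inner.Feasible G).sup (xUtil ω)

/-- `E u(F*)`: the optimal expected utility of a non-delegating principal. -/
noncomputable def optimum : ℝ≥0∞ :=
  ⨆ A : I.Algorithm, ∫⁻ ω, (I.principalValue ω (A.tree.probed ω) : ℝ≥0∞) ∂I.law

open Classical in
/-- The agent's utility from his favourite acceptable set of probed outcomes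
(`0` if there is none). -/
noncomputable def agentValue (R : Set (Finset (Outcome E))) (ω : State E) (F : Finset E) : ℝ≥0 :=
  (F.powerset.filter fun G => outcomes ω G ∈ R).sup (yUtil ω)

/-- The agent's expected utility under the policy `R` when he probes by the algorithm `A`. -/
noncomputable def agentUtility (R : Set (Finset (Outcome E))) (A : I.Algorithm) : ℝ≥0∞ :=
  ∫⁻ ω, (agentValue R ω (A.tree.probed ω) : ℝ≥0∞) ∂I.law

/-- The probability that the agent, probing by `A`, has an acceptable set to propose. -/
noncomputable def acceptProb (R : Set (Finset (Outcome E))) (A : I.Algorithm) : ℝ≥0∞ :=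
  I.law {ω | ∃ G ⊆ A.tree.probed ω, outcomes ω G ∈ R}

/-- `A` is an optimal adaptive probing algorithm of the agent under the policy `R`. -/
def IsOptimalAgent (R : Set (Finset (Outcome E))) (A : I.Algorithm) : Prop :=
  ∀ B : I.Algorithm, I.agentUtility R B ≤ I.agentUtility R A

/-- `A` is an optimal response of the agent to `R`. Probing is free, so an agent who is
indifferent does not forgo a proposal by not probing: among his optimal algorithms he uses one that
has an acceptable set to propose as often as possible. (Without an outer constraint, probing
everything is such a response whatever `R` is.) -/
def IsAgentResponse (R : Set (Finset (Outcome E))) (A : I.Algorithm) : Prop :=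
  I.IsOptimalAgent R A ∧
    ∀ B : I.Algorithm, I.IsOptimalAgent R B → I.acceptProb R B ≤ I.acceptProb R A

/-- In the state `ω`, with the elements of `F` probed, `G` is a favourite acceptable set of the
agent; if no acceptable set is available, then `G` is the empty (null) proposal. -/
def IsProposal (R : Set (Finset (Outcome E))) (ω : State E) (F G : Finset E) : Prop :=
  (G ⊆ F ∧ outcomes ω G ∈ R ∧ ∀ H ⊆ F, outcomes ω H ∈ R → yUtil ω H ≤ yUtil ω G) ∨
    ((∀ H ⊆ F, outcomes ω H ∉ R) ∧ G = ∅)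

/-- The deterministic policy `R ⊆ Ω_in` is an `α`-policy: `E v_R(F*_R) ≥ α E u(F*)`, for every
optimal response of the agent and all (even adversarial) ways `g` to break the ties between his
favourite acceptable sets. The integral is a lower integral if `g` is not measurable. -/
def IsAlphaPolicy (R : Set (Finset (Outcome E))) (α : ℝ≥0) : Prop :=
  R ⊆ I.innerOutcomes ∧
    ∀ A : I.Algorithm, I.IsAgentResponse R A →
      ∀ g : State E → Finset E, (∀ ω, IsProposal R ω (A.tree.probed ω) (g ω)) →
        (α : ℝ≥0∞) * I.optimum ≤ ∫⁻ ω, (xUtil ω (g ω) : ℝ≥0∞) ∂I.law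

end Problem

end DelegatedProbing

/-! Let `m` be the mean of the maximum weight of a feasible set, all utilities being known; it
bounds the non-delegating optimum. The agent may be assumed to find an acceptable set whenever one
exists, since probing everything is optimal for him. So a policy is worth at least any `φ` that lies
below the principal's utility for each acceptable set (`isAlphaPolicy_of_le`).

For finite `m > 0` put `b = m / 2` and call an individually feasible element large if its utility
exceeds `b`. If a large element exists with probability at least 1/2, accept feasible sets of
utility at least `b`. Otherwise no large element exists with probability at least 1/2. If the large
parts of the utilities have total mean at least `b`, accept single large elements: by independence
each is, with probability at least 1/2, without a large rival.

In the remaining case the optimum for utilities truncated at `b` has mean `m' ≥ b`. It is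
self-bounding: deleting one element lowers it by at most `b`, and these losses sum to at most the
optimum itself. Efron–Stein (`lmarginal_sq_le`) bounds its second moment by `m' ^ 2 + b * m' ≤ 2 *
m' ^ 2`, so it reaches `m' / 2` with probability at least 1/8 (`measure_half_mean_le`), and the
threshold `m' / 2` works. Only downward closure of the inner constraint enters. -/

namespace DelegatedProbing

/-! ### Second-moment inequalities. -/

/-- Efron–Stein inequality for a function `f = g i + d i` where `g i` does not depend on the
coordinate `i` and the increments `d i` are bounded by `b`. -/
theorem lmarginal_sq_le {ι : Type*} [DecidableEq ι] {X : ι → Type*}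
    [∀ i, MeasurableSpace (X i)] (μ : ∀ i, Measure (X i)) [∀ i, IsProbabilityMeasure (μ i)]
    {f : (∀ i, X i) → ℝ≥0∞} {g d : ι → (∀ i, X i) → ℝ≥0∞} {b : ℝ≥0∞}
    (hf : Measurable f) (hg : ∀ i, Measurable (g i)) (hd : ∀ i, Measurable (d i))
    (hfgd : ∀ i x, f x = g i x + d i x)
    (hgi : ∀ i x y, g i (Function.update x i y) = g i x)
    (hb : ∀ i x, d i x ≤ b) (s : Finset ι) (x : ∀ i, X i) :
    (∫⋯∫⁻_s, (fun x => f x ^ 2) ∂μ) x ≤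
      ((∫⋯∫⁻_s, f ∂μ) x) ^ 2 + b * ∑ i ∈ s, (∫⋯∫⁻_s, d i ∂μ) x := by
  induction s using Finset.induction generalizing x with
  | empty => simp
  | insert i s hi ih =>
    have hD : ∀ j, Measurable fun y => (∫⋯∫⁻_s, d j ∂μ) (Function.update x i y) := fun j =>
      ((hd j).lmarginal μ).comp (measurable_update x)
    have hDb : ∀ y, (∫⋯∫⁻_s, d i ∂μ) (Function.update x i y) ≤ b := fun y => by
      refine (lintegral_mono fun _ => hb i _).trans ?_
      simp
    have hsplit : ∀ y, (∫⋯∫⁻_s, f ∂μ) (Function.update x i y) =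
        (∫⋯∫⁻_s, g i ∂μ) x + (∫⋯∫⁻_s, d i ∂μ) (Function.update x i y) := fun y => by
      have h1 : (∫⋯∫⁻_s, g i ∂μ) x = (∫⋯∫⁻_s, g i ∂μ) (Function.update x i y) := by
        rw [lmarginal_update_of_notMem (hg i) hi]
        congr 1
        funext z
        exact (hgi i z y).symm
      rw [h1, show f = fun z => g i z + d i z from funext (hfgd i)]
      exact lintegral_add_left ((hg i).comp measurable_updateFinset) _
    rw [lmarginal_insert _ (hf.pow_const 2) hi, lmarginal_insert _ hf hi]
    simp_rw [fun j => lmarginal_insert (μ := μ) (s := s) (d j) (hd j) hi x]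
    rw [← lintegral_finsetSum _ fun j _ => hD j]
    set c := (∫⋯∫⁻_s, g i ∂μ) x
    -- By `hsplit` the marginal of `f` is `c + D` with `c` constant in `y`. In its square, `D ^ 2 ≤
    -- b * D` supplies the summand for the new coordinate.
    have key : ∀ y, (∫⋯∫⁻_s, (fun x => f x ^ 2) ∂μ) (Function.update x i y) ≤
        c ^ 2 + (2 * c * (∫⋯∫⁻_s, d i ∂μ) (Function.update x i y) +
          b * ∑ j ∈ insert i s, (∫⋯∫⁻_s, d j ∂μ) (Function.update x i y)) := fun y => by
      refine (ih _).trans ?_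
      rw [hsplit, Finset.sum_insert hi]
      generalize ∑ j ∈ s, (∫⋯∫⁻_s, d j ∂μ) (Function.update x i y) = S
      have hDb := hDb y
      generalize (∫⋯∫⁻_s, d i ∂μ) (Function.update x i y) = D at hDb ⊢
      calc (c + D) ^ 2 + b * S = c ^ 2 + 2 * c * D + D * D + b * S := by ring
        _ ≤ c ^ 2 + 2 * c * D + b * D + b * S := by gcongr
        _ = _ := by ring
    refine (lintegral_mono key).trans ?_
    rw [lintegral_add_left measurable_const, lintegral_add_left ((hD i).const_mul _),
      lintegral_const, measure_univ, mul_one, lintegral_const_mul _ (hD i),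
      lintegral_const_mul _ (Finset.measurable_sum _ fun j _ => hD j), ← add_assoc]
    gcongr
    simp_rw [hsplit]
    rw [lintegral_add_left measurable_const, lintegral_const, measure_univ, mul_one]
    generalize ∫⁻ y, (∫⋯∫⁻_s, d i ∂μ) (Function.update x i y) ∂μ i = D
    -- After integration `D` is a mean, so the remaining terms lie below the square of the full
    -- mean.
    calc c ^ 2 + 2 * c * D ≤ c ^ 2 + 2 * c * D + D ^ 2 := le_self_add
      _ = (c + D) ^ 2 := by ring

/-- A second moment bound of Paley–Zygmund type. -/
theorem measure_half_mean_le {Ω : Type*} [MeasurableSpace Ω] {P : Measure Ω}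
    [IsProbabilityMeasure P] {f : Ω → ℝ≥0∞} (hf : Measurable f) {m : ℝ≥0∞}
    (hm : ∫⁻ ω, f ω ∂P = m) (hm0 : m ≠ 0) (hmt : m ≠ ∞)
    (hsq : ∫⁻ ω, f ω ^ 2 ∂P ≤ 2 * m ^ 2) : 1 / 8 ≤ P {ω | m / 2 ≤ f ω} := by
  have hA : MeasurableSet {ω | m / 2 ≤ f ω} := measurableSet_le measurable_const hf
  lift m to ℝ≥0 using hmt
  have hm0' : m ≠ 0 := by exact_mod_cast hm0
  -- On the event, `t ≤ t ^ 2 / (8 * m) + 2 * m` because `(t - 4 * m) ^ 2 ≥ 0`. Integrating gives `m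
  -- ≤ m / 2 + m / 4 + 2 * m * p`, hence `p ≥ 1 / 8`.
  have hpt : ∀ ω, f ω ≤ (m / 2 : ℝ≥0∞) + ((1 / (8 * m) : ℝ≥0) * f ω ^ 2 +
      ({ω | (m / 2 : ℝ≥0∞) ≤ f ω}.indicator (fun _ => (2 * m : ℝ≥0∞)) ω)) := fun ω => by
    by_cases h : (m / 2 : ℝ≥0∞) ≤ f ω
    · rw [Set.indicator_of_mem (by exact h)]
      refine le_add_left ?_
      induction h' : f ω with
      | top => simp [hm0', ENNReal.mul_top]
      | coe t =>
        norm_cast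
        rw [← NNReal.coe_le_coe]
        push_cast
        have : (0 : ℝ) < m := by exact_mod_cast pos_iff_ne_zero.2 hm0'
        have h2 : 1 / (8 * (m : ℝ)) * t ^ 2 + 2 * m - t = (t - 4 * m) ^ 2 / (8 * m) := by
          field_simp
          ring
        have h3 : 0 ≤ (t - 4 * (m : ℝ)) ^ 2 / (8 * m) := by positivity
        linarith
    · exact le_add_right (not_le.1 h).le
  have hint := lintegral_mono (μ := P) hpt
  rw [hm, lintegral_add_left measurable_const, lintegral_add_left ((hf.pow_const 2).const_mul _),
    lintegral_const_mul _ (hf.pow_const 2), lintegral_indicator_const hA, lintegral_const,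
    measure_univ, mul_one] at hint
  have hp : P {ω | (m / 2 : ℝ≥0∞) ≤ f ω} ≠ ∞ := measure_ne_top _ _
  have hint2 : (m : ℝ≥0∞) ≤ m / 2 + ((1 / (8 * m) : ℝ≥0) * (2 * m ^ 2) +
      2 * m * P {ω | (m / 2 : ℝ≥0∞) ≤ f ω}) := hint.trans (by gcongr)
  generalize P {ω | (m / 2 : ℝ≥0∞) ≤ f ω} = p at hp hint2 ⊢
  lift p to ℝ≥0 using hp
  have e2 : (m / 2 : ℝ≥0∞) = ((m / 2 : ℝ≥0) : ℝ≥0∞) := by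
    rw [ENNReal.coe_div two_ne_zero]; rfl
  have e8 : (1 / 8 : ℝ≥0∞) = ((1 / 8 : ℝ≥0) : ℝ≥0∞) := by
    rw [ENNReal.coe_div (by norm_num)]; rfl
  rw [e2] at hint2
  rw [e8]
  norm_cast at hint2 ⊢
  rw [← NNReal.coe_le_coe] at hint2 ⊢
  push_cast at hint2 ⊢
  have hmp : (0 : ℝ) < m := by exact_mod_cast pos_iff_ne_zero.2 hm0'
  have h4 : 1 / (8 * (m : ℝ)) * (2 * m ^ 2) = m / 4 := by
    field_simp
    norm_num
  rw [h4] at hint2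
  by_contra hlt
  have := mul_lt_mul_of_pos_left (not_le.1 hlt) hmp
  linarith

/-! ### Maximum-weight feasible sets. -/

namespace SetSystem

variable {E : Type*} [Fintype E] (M : SetSystem E)

open Classical in
/-- The maximum weight of a feasible set. -/
noncomputable def maxWeight (w : E → ℝ≥0) : ℝ≥0 :=
  (Finset.univ.filter M.Feasible).sup fun G => ∑ e ∈ G, w e

variable {M}

theorem le_maxWeight {G : Finset E} (hG : M.Feasible G) (w : E → ℝ≥0) :
    ∑ e ∈ G, w e ≤ M.maxWeight w := by
  classical
  exact Finset.le_sup (f := fun G => ∑ e ∈ G, w e) (by simpa using hG)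

variable (M)

theorem exists_eq_maxWeight (w : E → ℝ≥0) :
    ∃ G, M.Feasible G ∧ ∑ e ∈ G, w e = M.maxWeight w := by
  classical
  obtain ⟨G, hG, h⟩ := Finset.exists_mem_eq_sup (Finset.univ.filter M.Feasible)
    ⟨∅, by simpa using M.empty_feasible⟩ fun G => ∑ e ∈ G, w e
  exact ⟨G, by simpa using hG, h.symm⟩

theorem maxWeight_le_iff {w : E → ℝ≥0} {c : ℝ≥0} :
    M.maxWeight w ≤ c ↔ ∀ G, M.Feasible G → ∑ e ∈ G, w e ≤ c := by
  classical
  simp [maxWeight]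

theorem maxWeight_mono {w w' : E → ℝ≥0} (h : w ≤ w') : M.maxWeight w ≤ M.maxWeight w' :=
  (M.maxWeight_le_iff).2 fun _ hG =>
    (Finset.sum_le_sum fun e _ => h e).trans (le_maxWeight hG w')

theorem measurable_maxWeight : Measurable M.maxWeight := by
  classical
  have hne : (Finset.univ.filter M.Feasible).Nonempty := ⟨∅, by simpa using M.empty_feasible⟩
  have h := Finset.measurable_sup' hne (f := fun G (w : E → ℝ≥0) => ∑ e ∈ G, w e)
    fun G _ => Finset.measurable_sum _ fun e _ => measurable_pi_apply e
  convert h using 1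
  funext w
  rw [Finset.sup'_apply, Finset.sup'_eq_sup]
  rfl

open Classical in
theorem maxWeight_le_update_zero_add (w : E → ℝ≥0) (e : E) :
    M.maxWeight w ≤ M.maxWeight (Function.update w e 0) + w e := by
  refine (M.maxWeight_le_iff).2 fun G hG => ?_
  refine le_trans ?_ (add_le_add_left (le_maxWeight hG _) _)
  by_cases he : e ∈ G
  · rw [Finset.sum_update_of_mem he, zero_add, Finset.sdiff_singleton_eq_erase,
      Finset.sum_erase_add _ _ he]
  · rw [Finset.sum_update_of_notMem he]
    exact le_self_add

-- The self-bounding property: for a fixed optimal set, elements outside it can be deleted without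
-- loss, and deleting a member costs at most its weight.
open Classical in
theorem sum_maxWeight_sub_update_zero_le (w : E → ℝ≥0) :
    ∑ e, (M.maxWeight w - M.maxWeight (Function.update w e 0)) ≤ M.maxWeight w := by
  obtain ⟨G, hG, h⟩ := M.exists_eq_maxWeight w
  calc ∑ e, (M.maxWeight w - M.maxWeight (Function.update w e 0))
      = ∑ e ∈ G, (M.maxWeight w - M.maxWeight (Function.update w e 0)) := by
        refine (Finset.sum_subset (Finset.subset_univ G) fun e _ he => ?_).symm
        rw [tsub_eq_zero_iff_le, ← h, ← Finset.sum_update_of_notMem he w 0]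
        exact le_maxWeight hG _
    _ ≤ ∑ e ∈ G, w e := Finset.sum_le_sum fun e _ =>
        tsub_le_iff_left.2 (M.maxWeight_le_update_zero_add w e)
    _ = M.maxWeight w := h

end SetSystem

/-! ### Sets of outcomes. -/

section Outcomes

variable {E : Type*} {ω : State E}

theorem mem_outcomes {G : Finset E} {o : Outcome E} :
    o ∈ outcomes ω G ↔ o.1 ∈ G ∧ o.2 = ω o.1 := by
  obtain ⟨e, z⟩ := o
  simp only [outcomes, Finset.mem_map]
  constructor
  · rintro ⟨a, ha, h⟩
    cases h
    exact ⟨ha, rfl⟩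
  · rintro ⟨he, h⟩
    exact ⟨e, he, congrArg (Prod.mk e) h.symm⟩

theorem eq_of_outcomes_eq {ω' : State E} {G H : Finset E} (h : outcomes ω G = outcomes ω' H) :
    G = H := by
  ext e
  constructor
  · intro he
    have := mem_outcomes.2 (show ((e, ω e) : Outcome E).1 ∈ G ∧ _ from ⟨he, rfl⟩)
    rw [h, mem_outcomes] at this
    exact this.1
  · intro he
    have := mem_outcomes.2 (show ((e, ω' e) : Outcome E).1 ∈ H ∧ _ from ⟨he, rfl⟩)
    rw [← h, mem_outcomes] at this
    exact this.1

theorem sum_outcomes (G : Finset E) : ∑ o ∈ outcomes ω G, o.2.1 = xUtil ω G := by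
  exact Finset.sum_map _ _ _

end Outcomes

/-! ### Non-adaptive probing. -/

namespace ProbeTree

variable {E : Type*}

/-- The procedure that probes the elements of a list one after the other. -/
def ofList : List E → ProbeTree E
  | [] => done
  | e :: l => probe e fun _ => ofList l

theorem mem_probed_ofList (ω : State E) (l : List E) (e : E) :
    e ∈ (ofList l).probed ω ↔ e ∈ l := by
  classical
  induction l with
  | nil => simp [ofList, probed]
  | cons a l ih => simp [ofList, probed, ih]

theorem valid_ofList (l : List E) (hl : l.Nodup) (P : Finset E) (hP : ∀ e ∈ l, e ∉ P) :
    (ofList l).Valid (SetSystem.trivial E) P := by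
  induction l generalizing P with
  | nil => simp [ofList, Valid]
  | cons a l ih =>
    classical
    rw [List.nodup_cons] at hl
    refine ⟨hP a (by simp), True.intro, fun _ => ih hl.2 _ fun e he => ?_⟩
    rw [Finset.mem_insert, not_or]
    exact ⟨fun h => hl.1 (h ▸ he), hP e (by simp [he])⟩

end ProbeTree

/-! ### The agent's response. -/

namespace Problem

variable {E : Type*} [Fintype E] (I : Problem E)

instance (e : E) : IsProbabilityMeasure (I.μ e) := I.isProb e

instance : IsProbabilityMeasure I.law := by
  unfold law
  infer_instance

theorem exists_algorithm_probed_eq_univ (hI : I.outer = SetSystem.trivial E) :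
    ∃ A : I.Algorithm, ∀ ω, A.tree.probed ω = Finset.univ := by
  have h : ∀ ω, (ProbeTree.ofList (Finset.univ : Finset E).toList).probed ω = Finset.univ :=
    fun ω => by
      ext e
      simp [ProbeTree.mem_probed_ofList]
  refine ⟨⟨ProbeTree.ofList (Finset.univ : Finset E).toList, ?_, fun F => ?_⟩, h⟩
  · rw [hI]
    exact ProbeTree.valid_ofList _ (Finset.nodup_toList _) _ (by simp)
  · simp only [h, MeasurableSet.const]

theorem ae_mem_support : ∀ᵐ ω ∂I.law, ∀ e, ω e ∈ (I.μ e).support := by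
  rw [ae_all_iff]
  intro e
  exact (measurePreserving_eval I.μ e).quasiMeasurePreserving.ae
    (p := fun z => z ∈ (I.μ e).support) Measure.support_mem_ae

theorem optimum_le : I.optimum ≤
    ∫⁻ ω, (I.inner.maxWeight fun e => (ω e).1 : ℝ≥0) ∂I.law := by
  classical
  refine iSup_le fun A => lintegral_mono fun ω => ENNReal.coe_le_coe.2 ?_
  refine Finset.sup_le fun G hG => ?_
  exact SetSystem.le_maxWeight (Finset.mem_filter.1 hG).2 fun e => (ω e).1

variable {I}

/-- As probing everything is optimal, an agent's response almost surely probes an acceptable set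
whenever there is one. -/
theorem IsAgentResponse.ae_exists_outcomes_mem (hI : I.outer = SetSystem.trivial E)
    {R : Set (Finset (Outcome E))} (hR : ∀ G, MeasurableSet {ω : State E | outcomes ω G ∈ R})
    {A : I.Algorithm} (hA : I.IsAgentResponse R A) :
    ∀ᵐ ω ∂I.law, (∃ G, outcomes ω G ∈ R) → ∃ G ⊆ A.tree.probed ω, outcomes ω G ∈ R := by
  classical
  obtain ⟨B, hB⟩ := I.exists_algorithm_probed_eq_univ hI
  have hBopt : I.IsOptimalAgent R B := fun C => by
    refine lintegral_mono fun ω => ENNReal.coe_le_coe.2 (Finset.sup_mono ?_)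
    rw [hB]
    exact Finset.filter_subset_filter _ (Finset.powerset_mono.2 (Finset.subset_univ _))
  have hle := hA.2 B hBopt
  have hmeas : MeasurableSet {ω | ∃ G ⊆ A.tree.probed ω, outcomes ω G ∈ R} := by
    have : {ω | ∃ G ⊆ A.tree.probed ω, outcomes ω G ∈ R} =
        ⋃ F : Finset E, ⋃ G ∈ F.powerset, ({ω | A.tree.probed ω = F} ∩ {ω | outcomes ω G ∈ R}) := by
      ext ω
      simp
    rw [this]
    exact .iUnion fun F => Finset.measurableSet_biUnion _ fun G _ => (A.measurable F).inter (hR G)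
  have hsub : {ω | ∃ G ⊆ A.tree.probed ω, outcomes ω G ∈ R} ⊆
      {ω | ∃ G ⊆ B.tree.probed ω, outcomes ω G ∈ R} := fun ω ⟨G, _, hG⟩ =>
    ⟨G, by simp [hB], hG⟩
  -- The tie-breaking rule makes the smaller of two nested events at least as probable as the
  -- larger, so they agree almost surely.
  filter_upwards [(ae_eq_of_subset_of_measure_ge hsub hle hmeas.nullMeasurableSet
    (measure_ne_top _ _)).mem_iff] with ω hω ⟨G, hG⟩
  exact hω.2 ⟨G, by simp [hB], hG⟩

/-- A lower bound `φ` on the principal's utility from every acceptable set yields a lower bound on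
his expected utility under delegation. -/
theorem isAlphaPolicy_of_le (hI : I.outer = SetSystem.trivial E)
    {R : Set (Finset (Outcome E))} (hRI : R ⊆ I.innerOutcomes)
    (hR : ∀ G, MeasurableSet {ω : State E | outcomes ω G ∈ R}) {φ : State E → ℝ≥0∞}
    (hφ : ∀ ω G, outcomes ω G ∈ R → φ ω ≤ xUtil ω G)
    (hφ0 : ∀ ω, (∀ e, ω e ∈ (I.μ e).support) → φ ω ≠ 0 → ∃ G, outcomes ω G ∈ R)
    {α : ℝ≥0} (hα : α * I.optimum ≤ ∫⁻ ω, φ ω ∂I.law) : I.IsAlphaPolicy R α := by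
  refine ⟨hRI, fun A hA g hg => hα.trans (lintegral_mono_ae ?_)⟩
  filter_upwards [hA.ae_exists_outcomes_mem hI hR, I.ae_mem_support] with ω h1 h2
  by_cases h0 : φ ω = 0
  · simp [h0]
  · obtain ⟨G, hG, hGR⟩ := h1 (hφ0 ω h2 h0)
    rcases hg ω with h | h
    · exact hφ ω _ h.2.1
    · exact absurd hGR (h.1 G hG)

variable (I)

omit [Fintype E] in
theorem outcomes_mem_innerOutcomes {ω : State E} {G : Finset E} :
    outcomes ω G ∈ I.innerOutcomes ↔
      (∀ e ∈ G, ω e ∈ (I.μ e).support) ∧ I.inner.Feasible G := by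
  constructor
  · rintro ⟨h, H, hH, ω', h'⟩
    rw [eq_of_outcomes_eq h']
    refine ⟨fun e he => h (e, ω e) ?_, hH⟩
    rw [mem_outcomes, eq_of_outcomes_eq h']
    exact ⟨he, rfl⟩
  · rintro ⟨h, hG⟩
    refine ⟨fun o ho => ?_, G, hG, ω, rfl⟩
    rw [mem_outcomes] at ho
    rw [ho.2]
    exact h _ ho.1

omit [Fintype E] in
theorem measurableSet_outcomes_mem_innerOutcomes (G : Finset E) :
    MeasurableSet {ω : State E | outcomes ω G ∈ I.innerOutcomes} := by
  simp only [outcomes_mem_innerOutcomes]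
  refine MeasurableSet.inter (s₁ := {ω : State E | ∀ e ∈ G, ω e ∈ (I.μ e).support}) ?_ (.const _)
  have : {ω : State E | ∀ e ∈ G, ω e ∈ (I.μ e).support} =
      ⋂ e ∈ G, (fun ω : State E => ω e) ⁻¹' (I.μ e).support := by
    ext ω
    simp
  rw [this]
  exact Finset.measurableSet_biInter _ fun e _ =>
    measurable_pi_apply e Measure.isClosed_support.measurableSet

theorem measurable_maxWeight_fst :
    Measurable fun ω : State E => I.inner.maxWeight fun e => (ω e).1 :=
  I.inner.measurable_maxWeight.comp (measurable_pi_lambda _ fun e => (measurable_pi_apply e).fst)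

/-! ### Threshold and singleton policies. -/

/-- Accept the feasible sets of total utility at least `τ`. -/
theorem exists_isAlphaPolicy_of_threshold (hI : I.outer = SetSystem.trivial E) (τ α : ℝ≥0)
    (h : α * I.optimum ≤ τ * I.law {ω | τ ≤ I.inner.maxWeight fun e => (ω e).1}) :
    ∃ R, I.IsAlphaPolicy R α := by
  refine ⟨{T : Finset (Outcome E) | T ∈ I.innerOutcomes ∧ τ ≤ (∑ o ∈ T, o.2.1 : ℝ≥0)}, isAlphaPolicy_of_le hI
    (fun T hT => hT.1) (fun G => ?_) (φ := Set.indicator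
      {ω : State E | τ ≤ I.inner.maxWeight fun e => (ω e).1} fun _ => (τ : ℝ≥0∞)) (fun ω G hG => ?_)
    (fun ω hω h0 => ?_) ?_⟩
  · simp only [Set.mem_ofPred_eq, sum_outcomes]
    have hx : Measurable fun ω : State E => xUtil ω G :=
      Finset.measurable_sum _ fun e _ => (measurable_pi_apply e).fst
    have hle : MeasurableSet {ω : State E | τ ≤ xUtil ω G} := measurableSet_le measurable_const hx
    exact (I.measurableSet_outcomes_mem_innerOutcomes G).inter hle
  · rw [Set.mem_ofPred_eq, sum_outcomes] at hG
    exact (Set.indicator_le_self _ _ _).trans (ENNReal.coe_le_coe.2 hG.2)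
  · have h1 : ω ∈ {ω : State E | τ ≤ I.inner.maxWeight fun e => (ω e).1} :=
      Set.mem_of_indicator_ne_zero h0
    obtain ⟨G, hG, hGe⟩ := I.inner.exists_eq_maxWeight fun e => (ω e).1
    refine ⟨G, I.outcomes_mem_innerOutcomes.2 ⟨fun e _ => hω e, hG⟩, ?_⟩
    rw [sum_outcomes]
    rw [Set.mem_ofPred_eq] at h1
    exact h1.trans hGe.ge
  · rwa [lintegral_indicator_const (measurableSet_le measurable_const I.measurable_maxWeight_fst)]

/-- Accept the single elements of `W` of utility larger than `b`. -/
theorem exists_isAlphaPolicy_of_singleton (hI : I.outer = SetSystem.trivial E) (W : Finset E)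
    (hW : ∀ e ∈ W, I.inner.Feasible {e}) (b α : ℝ≥0)
    (h : α * I.optimum ≤ ∫⁻ ω, ∑ e ∈ W, {ω : State E | b < (ω e).1 ∧
      ∀ f ∈ W, f ≠ e → (ω f).1 ≤ b}.indicator (fun ω => ((ω e).1 : ℝ≥0∞)) ω ∂I.law) :
    ∃ R, I.IsAlphaPolicy R α := by
  have hmem : ∀ (ω : State E) (G : Finset E), (∃ e ∈ W, ∃ z : ℝ≥0 × ℝ≥0, b < z.1 ∧
      outcomes ω G = {(e, z)}) ↔ ∃ e ∈ W, G = {e} ∧ b < (ω e).1 := fun ω G => by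
    constructor
    · rintro ⟨e, he, z, hz, hG⟩
      have hGe : G = {e} := eq_of_outcomes_eq (ω' := fun _ => z) (hG.trans (by rfl))
      subst hGe
      have : ((e, ω e) : Outcome E) ∈ outcomes ω {e} := mem_outcomes.2 ⟨by simp, rfl⟩
      rw [hG, Finset.mem_singleton] at this
      cases this
      exact ⟨e, he, rfl, hz⟩
    · rintro ⟨e, he, rfl, hb⟩
      exact ⟨e, he, ω e, hb, rfl⟩
  refine ⟨{T | T ∈ I.innerOutcomes ∧ ∃ e ∈ W, ∃ z : ℝ≥0 × ℝ≥0, b < z.1 ∧ T = {(e, z)}},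
    isAlphaPolicy_of_le hI (fun T hT => hT.1) (fun G => ?_) (fun ω G hG => ?_)
      (fun ω hω h0 => ?_) h⟩
  · simp only [Set.mem_ofPred_eq, hmem]
    refine MeasurableSet.inter (s₂ := {ω : State E | ∃ e ∈ W, G = {e} ∧ b < (ω e).1})
      (I.measurableSet_outcomes_mem_innerOutcomes G) ?_
    have : {ω : State E | ∃ e ∈ W, G = {e} ∧ b < (ω e).1} =
        ⋃ e ∈ W, {ω : State E | G = {e} ∧ b < (ω e).1} := by
      ext ω
      simp only [Set.mem_iUnion, Set.mem_ofPred_eq, exists_prop]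
    rw [this]
    have hlt : ∀ e, MeasurableSet {ω : State E | b < (ω e).1} := fun e =>
      measurableSet_lt measurable_const (measurable_pi_apply e).fst
    exact Finset.measurableSet_biUnion _ fun e _ => (MeasurableSet.const _).inter (hlt e)
  · obtain ⟨f, hf, rfl, hbf⟩ := (hmem ω G).1 hG.2
    -- An acceptable `{f}` is itself a large rival to every other `e`, so only the summand of `f`
    -- can survive.
    rw [Finset.sum_eq_single_of_mem f hf fun e _ hef => Set.indicator_of_notMem
      (fun hmem => (hmem.2 f hf hef.symm).not_gt hbf) _]
    refine (Set.indicator_le_self _ _ _).trans ?_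
    simp [xUtil]
  · obtain ⟨e, he, h1⟩ := Finset.exists_ne_zero_of_sum_ne_zero h0
    have hb := (Set.mem_of_indicator_ne_zero h1).1
    exact ⟨{e}, I.outcomes_mem_innerOutcomes.2 ⟨fun f _ => hω f, hW e he⟩,
      (hmem ω {e}).2 ⟨e, he, rfl, hb⟩⟩

/-- The utility of `e` is independent of the utilities of the elements of `W.erase e`. -/
theorem lintegral_indicator_exclusive (W : Finset E) (e : E) (b : ℝ≥0) :
    ∫⁻ ω, {ω : State E | b < (ω e).1 ∧ ∀ f ∈ W, f ≠ e → (ω f).1 ≤ b}.indicator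
        (fun ω => ((ω e).1 : ℝ≥0∞)) ω ∂I.law =
      (∫⁻ ω, {ω : State E | b < (ω e).1}.indicator (fun ω => ((ω e).1 : ℝ≥0∞)) ω ∂I.law) *
        I.law {ω | ∀ f ∈ W, f ≠ e → (ω f).1 ≤ b} := by
  classical
  have hind : ProbabilityTheory.iIndepFun (fun (i : E) (ω : State E) => ω i) I.law :=
    ProbabilityTheory.iIndepFun_pi (X := fun _ => id) fun _ => aemeasurable_id
  obtain ⟨T, hT⟩ : ∃ T, T = W.erase e := ⟨_, rfl⟩
  have h2 := hind.indepFun_finset {e} T (by simp [hT]) fun i => measurable_pi_apply i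
  have hs1 : MeasurableSet {z : ({e} : Finset E) → ℝ≥0 × ℝ≥0 | b < (z ⟨e, by simp⟩).1} :=
    measurableSet_lt measurable_const (measurable_pi_apply _).fst
  have hm1 : Measurable fun z : ({e} : Finset E) → ℝ≥0 × ℝ≥0 =>
      ((z ⟨e, by simp⟩).1 : ℝ≥0∞) := (measurable_pi_apply _).fst.coe_nnreal_ennreal
  have hs2 : MeasurableSet {z : T → ℝ≥0 × ℝ≥0 | ∀ f, (z f).1 ≤ b} := by
    have : {z : T → ℝ≥0 × ℝ≥0 | ∀ f, (z f).1 ≤ b} = ⋂ f, {z | (z f).1 ≤ b} := by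
      ext z
      simp
    rw [this]
    exact .iInter fun f => measurableSet_le (measurable_pi_apply f).fst measurable_const
  have hr1 : Measurable fun (ω : State E) (i : ({e} : Finset E)) => ω i :=
    measurable_pi_lambda _ fun i => measurable_pi_apply _
  have hr2 : Measurable fun (ω : State E) (i : T) => ω i :=
    measurable_pi_lambda _ fun i => measurable_pi_apply _
  have h3 := ProbabilityTheory.lintegral_mul_eq_lintegral_mul_lintegral_of_indepFun
    ((hm1.indicator hs1).comp hr1) ((measurable_one.indicator hs2).comp hr2)
    (h2.comp (hm1.indicator hs1) (measurable_one.indicator hs2))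
  have hset : (fun (ω : State E) (i : T) => ω i) ⁻¹' {z | ∀ f, (z f).1 ≤ b} =
      {ω | ∀ f ∈ W, f ≠ e → (ω f).1 ≤ b} := by
    ext ω
    simp [hT, imp.swap]
  have hc1 : (({z : ({e} : Finset E) → ℝ≥0 × ℝ≥0 | b < (z ⟨e, by simp⟩).1}.indicator fun z =>
      ((z ⟨e, by simp⟩).1 : ℝ≥0∞)) ∘ fun (ω : State E) i => ω i) =
      {ω : State E | b < (ω e).1}.indicator fun ω => ((ω e).1 : ℝ≥0∞) :=
    funext fun ω => (Set.indicator_comp_right (fun (ω : State E) (i : ({e} : Finset E)) => ω i)).symm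
  have hc2 : ({z : T → ℝ≥0 × ℝ≥0 | ∀ f, (z f).1 ≤ b}.indicator 1 ∘
      fun (ω : State E) (i : T) => ω i) =
      {ω | ∀ f ∈ W, f ≠ e → (ω f).1 ≤ b}.indicator (1 : State E → ℝ≥0∞) := by
    rw [← hset]
    exact funext fun ω => (Set.indicator_comp_right (fun (ω : State E) (i : T) => ω i)).symm
  rw [hc1, hc2, lintegral_indicator_one (hset ▸ hr2 hs2)] at h3
  refine Eq.trans (lintegral_congr fun ω => ?_) h3
  simp only [Pi.mul_apply, Set.indicator_apply, Set.mem_ofPred_eq, Pi.one_apply, mul_ite, mul_one,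
    mul_zero, ite_and]
  split_ifs <;> rfl

/-! ### Truncated utilities and large elements. -/

theorem one_eighth_le_measure_maxWeight_min (b : ℝ≥0) {m : ℝ≥0∞}
    (hm : ∫⁻ ω, (I.inner.maxWeight fun e => min (ω e).1 b : ℝ≥0) ∂I.law = m) (hm0 : m ≠ 0)
    (hmt : m ≠ ∞) (hb : b ≤ m) :
    1 / 8 ≤ I.law {ω | m / 2 ≤ (I.inner.maxWeight fun e => min (ω e).1 b : ℝ≥0)} := by
  classical
  set w : State E → E → ℝ≥0 := fun ω e => min (ω e).1 b with hw
  have hwm : Measurable w :=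
    measurable_pi_lambda _ fun e => (measurable_pi_apply e).fst.min measurable_const
  have hvm := I.inner.measurable_maxWeight
  have hgm : ∀ e, Measurable fun ω => I.inner.maxWeight (Function.update (w ω) e 0) := fun e =>
    hvm.comp (measurable_update_left.comp hwm)
  have hle : ∀ e ω, I.inner.maxWeight (Function.update (w ω) e 0) ≤ I.inner.maxWeight (w ω) :=
    fun e ω => I.inner.maxWeight_mono (update_le_self_iff.2 zero_le)
  have hfm : Measurable fun ω => (I.inner.maxWeight (w ω) : ℝ≥0∞) :=
    (hvm.comp hwm).coe_nnreal_ennreal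
  refine measure_half_mean_le hfm hm hm0 hmt ?_
  have hdm : ∀ e, Measurable fun ω => ((I.inner.maxWeight (w ω) -
      I.inner.maxWeight (Function.update (w ω) e 0) : ℝ≥0) : ℝ≥0∞) := fun e =>
    ((hvm.comp hwm).sub (hgm e)).coe_nnreal_ennreal
  -- Here `g e` is the truncated optimum with the weight of `e` set to zero. All coordinates are
  -- integrated out, so the base point `0` is immaterial.
  have h := lmarginal_sq_le I.μ (b := b) hfm (fun e => (hgm e).coe_nnreal_ennreal) hdm
    (fun e ω => by
      rw [← ENNReal.coe_add, add_tsub_cancel_of_le (hle e ω)])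
    (fun e ω y => by
      congr 2
      funext f
      by_cases hf : f = e
      · subst hf
        simp
      · simp [hf, hw])
    (fun e ω => ENNReal.coe_le_coe.2 <| (tsub_le_iff_left.2
      (I.inner.maxWeight_le_update_zero_add (w ω) e)).trans (min_le_right _ _))
    Finset.univ fun _ => 0
  simp only [lmarginal_univ] at h
  change ∫⁻ ω, (I.inner.maxWeight (w ω) : ℝ≥0∞) ^ 2 ∂I.law ≤
    (∫⁻ ω, (I.inner.maxWeight (w ω) : ℝ≥0∞) ∂I.law) ^ 2 + b * ∑ e, ∫⁻ ω, ((I.inner.maxWeight (w ω) -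
      I.inner.maxWeight (Function.update (w ω) e 0) : ℝ≥0) : ℝ≥0∞) ∂I.law at h
  rw [← lintegral_finsetSum _ fun e _ => hdm e, hm] at h
  refine h.trans ?_
  rw [two_mul]
  gcongr
  rw [sq]
  gcongr
  rw [← hm]
  refine lintegral_mono fun ω => ?_
  rw [← ENNReal.ofNNReal_finsetSum]
  exact ENNReal.coe_le_coe.2 (I.inner.sum_maxWeight_sub_update_zero_le (w ω))

open Classical in
/-- The elements that are feasible on their own. -/
noncomputable def feasibleElements : Finset E := Finset.univ.filter fun e => I.inner.Feasible {e}

/-- On an optimal set, each utility is at most its truncation plus, if it exceeds `b`, itself;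
downward closure makes each member individually feasible. -/
theorem maxWeight_le_min_add (ω : State E) (b : ℝ≥0) :
    ((I.inner.maxWeight fun e => (ω e).1 : ℝ≥0) : ℝ≥0∞) ≤
      (I.inner.maxWeight fun e => min (ω e).1 b : ℝ≥0) + ∑ e ∈ I.feasibleElements,
        {ω : State E | b < (ω e).1}.indicator (fun ω => ((ω e).1 : ℝ≥0∞)) ω := by
  obtain ⟨G, hG, h⟩ := I.inner.exists_eq_maxWeight fun e => (ω e).1
  have hGW : G ⊆ I.feasibleElements := fun e he => by
    simpa [feasibleElements] using I.inner.feasible_of_subset (by simpa using he) hG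
  rw [← h]
  calc ((∑ e ∈ G, (ω e).1 : ℝ≥0) : ℝ≥0∞)
      ≤ ∑ e ∈ G, ((min (ω e).1 b : ℝ≥0) +
          {ω : State E | b < (ω e).1}.indicator (fun ω => ((ω e).1 : ℝ≥0∞)) ω) := by
        rw [ENNReal.ofNNReal_finsetSum]
        refine Finset.sum_le_sum fun e _ => ?_
        by_cases hb : b < (ω e).1
        · rw [Set.indicator_of_mem (by exact hb)]
          exact le_add_self
        · rw [min_eq_left (not_lt.1 hb)]
          exact le_self_add
    _ ≤ _ := by
        rw [Finset.sum_add_distrib, ← ENNReal.ofNNReal_finsetSum]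
        gcongr
        exact SetSystem.le_maxWeight hG fun e => min (ω e).1 b

theorem lintegral_maxWeight_le (b : ℝ≥0) :
    ∫⁻ ω, (I.inner.maxWeight fun e => (ω e).1 : ℝ≥0) ∂I.law ≤
      ∫⁻ ω, (I.inner.maxWeight fun e => min (ω e).1 b : ℝ≥0) ∂I.law +
        ∑ e ∈ I.feasibleElements, ∫⁻ ω,
          {ω : State E | b < (ω e).1}.indicator (fun ω => ((ω e).1 : ℝ≥0∞)) ω ∂I.law := by
  have hm : ∀ e, Measurable
      ({ω : State E | b < (ω e).1}.indicator (fun ω => ((ω e).1 : ℝ≥0∞))) := fun e =>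
    (measurable_pi_apply e).fst.coe_nnreal_ennreal.indicator
      (measurableSet_lt measurable_const (measurable_pi_apply e).fst)
  rw [← lintegral_finsetSum _ fun e _ => hm e,
    ← lintegral_add_right _ (Finset.measurable_sum _ fun e _ => hm e)]
  exact lintegral_mono fun ω => I.maxWeight_le_min_add ω b

/-- Truncation at `0` leaves only a finite sum of single means, so some individually feasible
element has infinite mean, and accepting it alone suffices for any `α`. -/
theorem exists_isAlphaPolicy_of_lintegral_eq_top (hI : I.outer = SetSystem.trivial E) (α : ℝ≥0)
    (hm : ∫⁻ ω, (I.inner.maxWeight fun e => (ω e).1 : ℝ≥0) ∂I.law = ∞) :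
    ∃ R, I.IsAlphaPolicy R α := by
  have h := I.lintegral_maxWeight_le 0
  have h0 : I.inner.maxWeight (fun _ => 0) = 0 := by
    simpa using I.inner.maxWeight_le_iff (w := fun _ => 0) (c := 0)
  simp only [hm, min_eq_right zero_le, h0, ENNReal.coe_zero, lintegral_zero, zero_add,
    top_le_iff, ENNReal.sum_eq_top] at h
  obtain ⟨e, he, hint⟩ := h
  refine I.exists_isAlphaPolicy_of_singleton hI {e} (fun f hf => ?_) 0 α ?_
  · rw [Finset.mem_singleton.1 hf]
    simpa [feasibleElements] using he
  · simp only [Finset.sum_singleton]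
    rw [I.lintegral_indicator_exclusive {e} e 0, hint]
    simp

/-! ### The case analysis. -/

/-- If the inner constraint is downwards closed and there is no outer constraint, then a
deterministic policy gives the principal a constant fraction of his non-delegating optimum. -/
theorem exists_isAlphaPolicy (hI : I.outer = SetSystem.trivial E) :
    ∃ R, I.IsAlphaPolicy R 32⁻¹ := by
  obtain ⟨m, hm⟩ : ∃ m, m = ∫⁻ ω, (I.inner.maxWeight fun e => (ω e).1 : ℝ≥0) ∂I.law := ⟨_, rfl⟩
  by_cases hmt : m = ∞
  · exact I.exists_isAlphaPolicy_of_lintegral_eq_top hI _ (hm.symm.trans hmt)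
  have hopt : ∀ v : ℝ≥0∞, m ≤ 32 * v → ((32⁻¹ : ℝ≥0) : ℝ≥0∞) * I.optimum ≤ v := fun v hv => by
    rw [ENNReal.coe_inv (by norm_num)]
    refine (ENNReal.inv_mul_le_iff (by norm_num) (by norm_num)).2 ?_
    exact I.optimum_le.trans (hm ▸ hv)
  by_cases hm0 : m = 0
  · exact I.exists_isAlphaPolicy_of_threshold hI 0 _ (hopt _ (by simp [hm0]))
  lift m to ℝ≥0 using hmt
  have hbm : ((m / 2 : ℝ≥0) : ℝ≥0∞) + (m / 2 : ℝ≥0) = m := by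
    rw [← ENNReal.coe_add, add_halves]
  set b : ℝ≥0 := m / 2
  set W := I.feasibleElements
  have hW : ∀ e ∈ W, I.inner.Feasible {e} := fun e he => by
    simpa [W, feasibleElements] using he
  have hlt : ∀ e, MeasurableSet {ω : State E | b < (ω e).1} := fun e =>
    measurableSet_lt measurable_const (measurable_pi_apply e).fst
  -- This case and the next lose only a factor 4; the 32 comes from the last one.
  by_cases hp : 1 / 2 ≤ I.law {ω | ∃ e ∈ W, b < (ω e).1}
  · refine I.exists_isAlphaPolicy_of_threshold hI b _ (hopt _ ?_)
    have hsub : {ω : State E | ∃ e ∈ W, b < (ω e).1} ⊆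
        {ω | b ≤ I.inner.maxWeight fun e => (ω e).1} := fun ω ⟨e, he, hbe⟩ =>
      hbe.le.trans (by simpa using SetSystem.le_maxWeight (hW e he) fun e => (ω e).1)
    have h2 := hp.trans (measure_mono hsub)
    calc (m : ℝ≥0∞) = b + b := hbm.symm
      _ = 2 * b * (2 * (1 / 2)) := by
        rw [ENNReal.mul_div_cancel (by norm_num) (by norm_num)]
        ring
      _ = 4 * (b * (1 / 2)) := by ring
      _ ≤ 32 * (b * (1 / 2)) := by
        gcongr
        norm_num
      _ ≤ _ := by gcongr
  have hB : MeasurableSet {ω : State E | ∃ e ∈ W, b < (ω e).1} := by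
    have : {ω : State E | ∃ e ∈ W, b < (ω e).1} = ⋃ e ∈ W, {ω : State E | b < (ω e).1} := by
      ext ω
      simp only [Set.mem_iUnion, Set.mem_ofPred_eq, exists_prop]
    rw [this]
    exact Finset.measurableSet_biUnion _ fun e _ => hlt e
  have hq : 1 / 2 ≤ I.law {ω | ∃ e ∈ W, b < (ω e).1}ᶜ := by
    rw [prob_compl_eq_one_sub hB]
    refine ENNReal.le_sub_of_add_le_left (measure_ne_top _ _) ?_
    calc _ ≤ (1 / 2 : ℝ≥0∞) + 1 / 2 := by gcongr; exact (not_le.1 hp).le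
      _ = 1 := ENNReal.add_halves 1
  have hX : ∀ e, Measurable fun ω : State E => ((ω e).1 : ℝ≥0∞) := fun e =>
    (measurable_pi_apply e).fst.coe_nnreal_ennreal
  have hle := I.lintegral_maxWeight_le b
  rw [← hm] at hle
  by_cases hS : (b : ℝ≥0∞) ≤ ∑ e ∈ W, ∫⁻ ω,
      {ω : State E | b < (ω e).1}.indicator (fun ω => ((ω e).1 : ℝ≥0∞)) ω ∂I.law
  · refine I.exists_isAlphaPolicy_of_singleton hI W hW b _ (hopt _ ?_)
    have hset : ∀ e, MeasurableSet {ω : State E | b < (ω e).1 ∧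
        ∀ f ∈ W, f ≠ e → (ω f).1 ≤ b} := fun e => by
      have : {ω : State E | b < (ω e).1 ∧ ∀ f ∈ W, f ≠ e → (ω f).1 ≤ b} =
          {ω : State E | b < (ω e).1} ∩ ⋂ f ∈ W, {ω : State E | f ≠ e → (ω f).1 ≤ b} := by
        ext ω
        simp only [Set.mem_inter_iff, Set.mem_iInter, Set.mem_ofPred_eq]
      rw [this]
      refine (hlt e).inter (Finset.measurableSet_biInter _ fun f _ => ?_)
      by_cases hf : f = e
      · simp [hf]
      · simp only [ne_eq, hf, not_false_eq_true, forall_true_left]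
        exact measurableSet_le (measurable_pi_apply f).fst measurable_const
    rw [lintegral_finsetSum _ fun e _ => (hX e).indicator (hset e)]
    simp_rw [I.lintegral_indicator_exclusive W _ b]
    -- The absence of any large element implies the absence of rivals to `e`, which bounds every
    -- factor below by 1/2.
    have hsub : ∀ e, {ω : State E | ∃ e ∈ W, b < (ω e).1}ᶜ ⊆
        {ω | ∀ f ∈ W, f ≠ e → (ω f).1 ≤ b} := fun e ω hω f hf _ =>
      not_lt.1 fun h => hω ⟨f, hf, h⟩
    calc (m : ℝ≥0∞) = b + b := hbm.symm
      _ = 2 * b * (2 * (1 / 2)) := by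
        rw [ENNReal.mul_div_cancel (by norm_num) (by norm_num)]
        ring
      _ = 4 * (b * (1 / 2)) := by ring
      _ ≤ 32 * (b * (1 / 2)) := by
        gcongr
        norm_num
      _ ≤ _ := by
        gcongr
        refine (mul_le_mul_left hS _).trans ?_
        rw [Finset.sum_mul]
        gcongr with e _
        exact hq.trans (measure_mono (hsub e))
  obtain ⟨m', hm'⟩ : ∃ m', m' =
    ∫⁻ ω, (I.inner.maxWeight fun e => min (ω e).1 b : ℝ≥0) ∂I.law := ⟨_, rfl⟩
  rw [← hm'] at hle
  -- The large parts account for less than half of `m`. This is the condition "increments at most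
  -- the mean" of the concentration bound.
  have hbm' : (b : ℝ≥0∞) ≤ m' := by
    refine (ENNReal.add_le_add_iff_right (ENNReal.coe_ne_top (r := b))).1 ?_
    rw [hbm]
    exact hle.trans (by gcongr; exact (not_le.1 hS).le)
  have hm'm : m' ≤ m := by
    rw [hm, hm']
    exact lintegral_mono fun ω => ENNReal.coe_le_coe.2
      (I.inner.maxWeight_mono fun e => min_le_left _ _)
  have hb0 : (b : ℝ≥0∞) ≠ 0 := fun h => hm0 (by rw [← hbm, h, add_zero])
  lift m' to ℝ≥0 using ne_top_of_le_ne_top ENNReal.coe_ne_top hm'm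
  have hpz := I.one_eighth_le_measure_maxWeight_min b hm'.symm
    (fun h => hb0 (le_antisymm (h ▸ hbm') zero_le)) ENNReal.coe_ne_top hbm'
  refine I.exists_isAlphaPolicy_of_threshold hI (m' / 2) _ (hopt _ ?_)
  have hsub : {ω : State E | (m' / 2 : ℝ≥0∞) ≤
      (I.inner.maxWeight fun e => min (ω e).1 b : ℝ≥0)} ⊆
      {ω | m' / 2 ≤ I.inner.maxWeight fun e => (ω e).1} := fun ω hω => by
    rw [Set.mem_ofPred_eq] at hω ⊢
    have h1 : m' / 2 ≤ I.inner.maxWeight fun e => min (ω e).1 b := by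
      rw [← ENNReal.coe_le_coe, ENNReal.coe_div two_ne_zero]
      exact hω
    exact h1.trans (I.inner.maxWeight_mono fun e => min_le_left _ _)
  have h8 := hpz.trans (measure_mono hsub)
  -- A factor 4 from `m ≤ 2 * m'` and the threshold `m' / 2`, and a factor 8 from the probability.
  calc (m : ℝ≥0∞) = b + b := hbm.symm
    _ ≤ m' + m' := by gcongr
    _ = 4 * ((m' / 2 : ℝ≥0) : ℝ≥0∞) := by
      norm_cast
      rw [← NNReal.coe_inj]
      push_cast
      ring
    _ = 4 * (m' / 2 : ℝ≥0) * (8 * (1 / 8)) := by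
      rw [ENNReal.mul_div_cancel (by norm_num) (by norm_num), mul_one]
    _ = 32 * ((m' / 2 : ℝ≥0) * (1 / 8)) := by ring
    _ ≤ _ := by gcongr

end Problem

end DelegatedProbing

theorem mainTheorem5 (k : ℕ) :
    ∃ α : ℝ≥0, 0 < α ∧ α ≤ 1 ∧
      ∀ (E : Type*) [Fintype E] (I : DelegatedProbing.Problem E),
        I.outer = DelegatedProbing.SetSystem.trivial E →
        I.inner.IsIntersectionOf k →
        ∃ R : Set (Finset (DelegatedProbing.Outcome E)), I.IsAlphaPolicy R α := by
  refine ⟨32⁻¹, by norm_num, inv_le_one_of_one_le₀ (by norm_num), fun E _ I hI _ => ?_⟩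
  exact I.exists_isAlphaPolicy hI
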